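/- All graphs are finite and simple. A tree decomposition of a graph $G$ is a pair $(T,\beta)$, where $T$ is a tree and $\beta$ assigns to each node of $T$ a set of vertices of $G$, such that for every edge $uv$ of $G$ some node $z$ has $\{u,v\}\subseteq\beta(z)$, and for every vertex $v$ of $G$ the set $\{z: v\in\beta(z)\}$ induces a non-empty connected subtree of $T$. Its width is $\max_z|\beta(z)|-1$, and the tree-width of $G$ is the minimum width of a tree decomposition of $G$. A path decomposition is a tree decomposition $(P,\beta)$ where $P=z_0z_1\dots z_n$ is a path; it is nice if $\beta(z_0)=\emptyset$ and $|\beta(z_i)\setminus\beta(z_{i-1})|=1$ for $i=1,\dots,n$, and then $v_i$ denotes the unique element of $\beta(z_i)\setminus\beta(z_{i-1})$. Graphs given to an on-line algorithm have their vertices in a fixed infinite set $U$. An on-line coloring algorithm $\mathcal A$ is a function from the triples $(H,Q,\gamma)$, where $H$ is a graph with a nice path decomposition $(Q,\gamma)$, to the integers such that, for every graph $G$ with a nice path decomposition $(P,\beta)$, $P=z_0z_1\dots z_n$, the assignment $\varphi(v_i)=\mathcal A(G_i,P_i,\beta_i)$ is a proper coloring of $G$; here $G_i=G-\{v_{i+1},\dots,v_n\}$,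 $P_i=z_0\dots z_i$, and $\beta_i$ is the restriction of $\beta$ to $P_i$. The number of colors used by $\varphi$ is denoted $\chi_{\mathcal A}(G,P,\beta)$. Let $t$ and $k$ be positive integers. The maximum $c$ of $\chi(G)$ over all $K_k$-free graphs $G$ of tree-width at most $t$ exists, and there is an on-line coloring algorithm $\mathcal A$ such that every $K_k$-free graph $H$ with a nice path decomposition $(P,\beta)$ of width at most $t$ satisfies $\chi_{\mathcal A}(H,P,\beta)\le c$. Conversely, if $c'\ge 0$ is an integer and an on-line coloring algorithm $\mathcal A'$ satisfies $\chi_{\mathcal A'}(H,P,\beta)\le c'$ for every $K_k$-free graph $H$ with a nice path decomposition $(P,\beta)$ of width at most $t$, then $\chi(G)\le c'$ for every $K_k$-free graph $G$ of tree-width at most $t$. -/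

import Mathlib

universe u v

namespace OnlineColoring

/-- `(T, β)` is a tree decomposition of the graph `G`: `T` is a tree, every edge of `G` lies in
some bag, and for every vertex `x` of `G` the nodes whose bags contain `x` induce a non-empty
connected subgraph of `T` (`Connected` includes non-emptiness). -/
structure IsTreeDecomposition {V : Type*} {N : Type*} (G : SimpleGraph V) (T : SimpleGraph N)
    (β : N → Set V) : Prop where
  isTree : T.IsTree
  exists_bag_of_adj : ∀ x y : V, G.Adj x y → ∃ z : N, x ∈ β z ∧ y ∈ β z
  connected : ∀ x : V, (T.induce {z : N | x ∈ β z}).Connected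

/-- The width of a finite family of bags: the maximal size of a bag, minus one. -/
noncomputable def width {V : Type*} {N : Type*} (β : N → Set V) : ℤ :=
  (⨆ z : N, ((β z).ncard : ℤ)) - 1

/-- The tree-width of a finite graph `G`: the minimum width of a (finite) tree decomposition. -/
noncomputable def treeWidth {V : Type*} (G : SimpleGraph V) : ℤ :=
  sInf {w : ℤ | ∃ (N : Type) (_ : Finite N) (T : SimpleGraph N) (β : N → Set V),
    IsTreeDecomposition G T β ∧ width β = w}

/-- The data of a triple `(H, Q, γ)`: a graph `H` whose vertices are elements of `U`
(`H.verts : Set U` is its vertex set), a path `Q = z_0 z_1 … z_n`, and a bag for each node. -/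
structure PathPresentation (U : Type u) where
  graph : (⊤ : SimpleGraph U).Subgraph
  n : ℕ
  bag : Fin (n + 1) → Set U

namespace PathPresentation

variable {U : Type u}

/-- The vertices introduced in step `i`, that is, the bag of `z_{i+1}` minus the bag of `z_i`
(steps are numbered from `0`). For a nice path decomposition this set is a singleton. -/
def new (P : PathPresentation U) (i : Fin P.n) : Set U :=
  P.bag i.succ \ P.bag i.castSucc

/-- The bags form a nice path decomposition of the graph. -/
structure IsNice (P : PathPresentation U) : Prop where
  bag_subset : ∀ z, P.bag z ⊆ P.graph.verts
  isPathDecomposition : IsTreeDecomposition P.graph.coe (SimpleGraph.pathGraph (P.n + 1))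
    (fun z => {x : P.graph.verts | (x : U) ∈ P.bag z})
  bag_zero : P.bag 0 = ∅
  ncard_new : ∀ i : Fin P.n, (P.new i).ncard = 1

/-- What has been revealed after step `i`: the vertices introduced in later steps are deleted
from the graph, and the path is cut after the node `z_{i+1}`. -/
def upTo (P : PathPresentation U) (i : Fin P.n) : PathPresentation U where
  graph := P.graph.deleteVerts {x : U | ∃ j : Fin P.n, i < j ∧ x ∈ P.new j}
  n := i + 1
  bag := fun z => P.bag (Fin.castLE (by omega) z)

end PathPresentation

/-- An on-line coloring algorithm: the vertex introduced in step `i` gets the color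
`color (P.upTo i)`, and for every graph with a nice path decomposition the resulting coloring
is proper. The values of `color` at data that are not nice path decompositions play no role. -/
structure OnlineColoringAlgorithm (U : Type u) where
  color : PathPresentation U → ℤ
  proper : ∀ P : PathPresentation U, P.IsNice → ∀ i j : Fin P.n, ∀ x ∈ P.new i, ∀ y ∈ P.new j,
    P.graph.Adj x y → color (P.upTo i) ≠ color (P.upTo j)

/-- The number of colors that `A` uses on the graph of `P`, presented according to `P`. Every
vertex of the graph is introduced in exactly one step of a nice path decomposition. -/
noncomputable def OnlineColoringAlgorithm.numColors {U : Type u} (A : OnlineColoringAlgorithm U)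
    (P : PathPresentation U) : ℕ :=
  (Set.range fun i : Fin P.n => A.color (P.upTo i)).ncard

end OnlineColoring

/-!
Both halves compare nice path decompositions with rooted tree decompositions in which every node
other than the root introduces exactly one vertex. Such a `Layout` with bags of size at most `t + 1`
exists for a finite graph if and only if its tree-width is at most `t`
(`Layout.exists_of_treeWidth_le`, `Layout.treeWidth_le`), and the path from its root to a node is a
nice path decomposition of width at most `t`. Greedy coloring along a layout bounds the chromatic
number by `t + 1` (`Layout.colorable`), so that the maximum `c` exists.

For the on-line algorithm, all admissible presentations (nice, `K_k`-free, of width at most `t`) are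
put together into one infinite tree, ordered by continuation. The corresponding graph
`universalGraph` is `K_k`-free, since a clique consists of prefixes of one presentation, and its
finite subgraphs have tree-width at most `t` (`nonempty_layout_universalGraph`). Hence its finite
subgraphs are `c`-colorable, and by compactness so is the whole graph. The algorithm gives to a new
vertex the color of the presentation seen so far (`exists_algorithm`).

Conversely, let an algorithm use at most `c'` colors on each admissible presentation, and let `G` be
a `K_k`-free graph with a layout. Presenting the path from the root to `x`, for each vertex `x`, and
recording the color of `x` colors `G` properly, since adjacent vertices lie on a common path. But
different paths could receive different sets of colors. This is prevented by presenting first a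
graph disjoint from `G` on which the algorithm uses as many colors as it ever does; after that it
has to reuse these colors (`colorable_of_algorithm`).
-/

namespace OnlineColoring

/-! ### Rooted trees -/

open SimpleGraph

/-- A graph in which each node other than the root `r` is joined exactly to its parent, of smaller
rank, and to its children is a tree: it is connected, and it has at most one edge for each node
other than `r`. -/
theorem isTree_of_parent {N : Type*} [Finite N] (T : SimpleGraph N) (r : N) (par : N → N)
    (rank : N → ℕ) (hrank : ∀ x, x ≠ r → rank (par x) < rank x)
    (hT : ∀ x y, T.Adj x y ↔ (x ≠ r ∧ par x = y) ∨ (y ≠ r ∧ par y = x)) : T.IsTree := by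
  have hconn : T.Connected := by
    rw [connected_iff_exists_forall_reachable]
    refine ⟨r, fun w => ?_⟩
    induction hn : rank w using Nat.strong_induction_on generalizing w with
    | _ n ih =>
      by_cases hw : w = r
      · rw [hw]
      · have h1 := ih _ (hn ▸ hrank w hw) (par w) rfl
        exact h1.trans ((hT _ _).2 (Or.inr ⟨hw, rfl⟩)).reachable
  rw [isTree_iff_connected_and_card]
  refine ⟨hconn, le_antisymm ?_ hconn.card_vert_le_card_edgeSet_add_one⟩
  have hsub : T.edgeSet ⊆ (fun x => s(x, par x)) '' {x | x ≠ r} := by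
    intro e he
    induction e with
    | _ x y =>
      rcases (hT x y).1 he with ⟨hx, rfl⟩ | ⟨hy, rfl⟩
      · exact ⟨x, hx, rfl⟩
      · exact ⟨y, hy, Sym2.eq_swap⟩
  have h1 : T.edgeSet.ncard ≤ ({x | x ≠ r} : Set N).ncard :=
    (Set.ncard_le_ncard hsub (Set.toFinite _)).trans (Set.ncard_image_le (Set.toFinite _))
  have h2 : ({x | x ≠ r} : Set N).ncard + 1 = Nat.card N := by
    have := Set.ncard_add_ncard_compl ({r} : Set N)
    rw [Set.ncard_singleton] at this
    have h3 : ({x | x ≠ r} : Set N) = {r}ᶜ := by ext; simp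
    rw [h3]; omega
  rw [Nat.card_coe_set_eq]
  omega

theorem connected_induce_of_parent {N : Type*} (T : SimpleGraph N) (r : N) (par : N → N)
    (rank : N → ℕ) (hrank : ∀ x, x ≠ r → rank (par x) < rank x)
    (hT : ∀ x y, T.Adj x y ↔ (x ≠ r ∧ par x = y) ∨ (y ≠ r ∧ par y = x))
    (X : Set N) (q : N) (hq : q ∈ X) (hX : ∀ x ∈ X, x ≠ q → x ≠ r ∧ par x ∈ X) :
    (T.induce X).Connected := by
  rw [connected_iff_exists_forall_reachable]
  refine ⟨⟨q, hq⟩, ?_⟩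
  rintro ⟨w, hw⟩
  induction hn : rank w using Nat.strong_induction_on generalizing w with
  | _ n ih =>
    by_cases hwq : w = q
    · subst hwq; rfl
    · obtain ⟨hr, hp⟩ := hX w hw hwq
      have h1 := ih _ (hn ▸ hrank w hr) (par w) hp rfl
      refine h1.trans (Adj.reachable ?_)
      exact (hT _ _).2 (Or.inr ⟨hr, rfl⟩)

theorem exists_adj_dist_lt {N : Type*} {T : SimpleGraph N} (hT : T.Connected) {x r : N}
    (h : x ≠ r) : ∃ y, T.Adj x y ∧ T.dist y r < T.dist x r := by
  obtain ⟨p, hp⟩ := hT.exists_walk_length_eq_dist x r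
  cases p with
  | nil => exact absurd rfl h
  | cons hxy q =>
    refine ⟨_, hxy, ?_⟩
    have := dist_le q
    rw [Walk.length_cons] at hp
    omega

theorem reachable_deleteEdges_root {N : Type*} {T : SimpleGraph N} (hT : T.Connected) {x y r z : N}
    (hzx : z ≠ x) (hz : T.dist z r ≤ T.dist x r) :
    (T.deleteEdges {s(x, y)}).Reachable z r := by
  induction hn : T.dist z r using Nat.strong_induction_on generalizing z with
  | _ n ih =>
    by_cases hzr : z = r
    · rw [hzr]
    · obtain ⟨w, hzw, hw⟩ := exists_adj_dist_lt hT hzr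
      have hwx : w ≠ x := by rintro rfl; omega
      refine Reachable.trans (Adj.reachable ?_) (ih _ (hn ▸ hw) hwx (by omega) rfl)
      rw [deleteEdges_adj]
      refine ⟨hzw, ?_⟩
      simp only [Set.mem_singleton_iff, Sym2.eq_iff]
      tauto

/-- In a tree rooted at `r`, a connected set of nodes contains with `x` the parent of `x`, unless
`x` is its node `m` closest to the root. Otherwise the edge from `x` to its parent `y` would not be
a bridge: `x` leads to `m` inside the set, and both `m` and `y` lead to the root avoiding `x`. -/
theorem parent_mem_of_connected {N : Type*} {T : SimpleGraph N} (hT : T.IsTree) {r x y m : N}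
    {X : Set N} (hX : (T.induce X).Connected) (hx : x ∈ X) (hm : m ∈ X)
    (hmin : ∀ z ∈ X, T.dist m r ≤ T.dist z r) (hxm : x ≠ m) (hxy : T.Adj x y)
    (hd : T.dist y r < T.dist x r) : y ∈ X := by
  by_contra hy
  have hb := isAcyclic_iff_forall_adj_isBridge.1 hT.isAcyclic hxy
  rw [isBridge_iff] at hb
  apply hb
  have hyx : y ≠ x := hxy.ne'
  have h1 := reachable_deleteEdges_root (y := y) hT.connected hyx hd.le
  have h2 := reachable_deleteEdges_root (y := y) hT.connected hxm.symm (hmin x hx)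
  let f : T.induce X →g T.deleteEdges {s(x, y)} :=
    { toFun := Subtype.val
      map_rel' := by
        rintro ⟨a, ha⟩ ⟨b, hb⟩ hab
        rw [deleteEdges_adj]
        refine ⟨hab, ?_⟩
        simp only [Set.mem_singleton_iff, Sym2.eq_iff, not_or, not_and]
        exact ⟨fun _ h => hy (h ▸ hb), fun h => absurd (h ▸ ha) hy⟩ }
  have h3 : (T.deleteEdges {s(x, y)}).Reachable x m := (hX.preconnected ⟨x, hx⟩ ⟨m, hm⟩).map f
  exact h3.trans (h2.trans h1.symm)

/-- If two subtrees of a rooted tree intersect, then the one whose top node is closer to the root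
contains the top node of the other. -/
theorem top_mem_of_inter {N : Type*} {T : SimpleGraph N} (hT : T.IsTree) {r a b : N}
    {X Y : Set N} (hX : (T.induce X).Connected) (hY : (T.induce Y).Connected)
    (ha : a ∈ X) (hamin : ∀ z ∈ X, T.dist a r ≤ T.dist z r)
    (hb : b ∈ Y) (hbmin : ∀ z ∈ Y, T.dist b r ≤ T.dist z r)
    (hab : T.dist a r ≤ T.dist b r) (z : N) (hzX : z ∈ X) (hzY : z ∈ Y) : b ∈ X := by
  induction hn : T.dist z r using Nat.strong_induction_on generalizing z with
  | _ n ih =>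
    by_cases hzb : z = b
    · exact hzb ▸ hzX
    by_cases hzr : z = r
    · have h1 := hbmin z hzY
      rw [hzr, dist_self, Nat.le_zero, hT.connected.dist_eq_zero_iff] at h1
      exact absurd (hzr.trans h1.symm) hzb
    obtain ⟨y, hzy, hy⟩ := exists_adj_dist_lt hT.connected hzr
    have hyY := parent_mem_of_connected hT hY hzY hb hbmin hzb hzy hy
    by_cases hza : z = a
    · have := hbmin y hyY
      subst hza
      omega
    · exact ih _ (hn ▸ hy) y (parent_mem_of_connected hT hX hzX ha hamin hza hzy hy) hyY rfl

/-! ### Layouts: tree decompositions indexed by the vertices -/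

theorem width_le_iff {V N : Type*} [Finite N] [Nonempty N] (β : N → Set V) (t : ℕ) :
    width β ≤ t ↔ ∀ z, (β z).ncard ≤ t + 1 := by
  unfold width
  rw [sub_le_iff_le_add, ciSup_le_iff (Set.finite_range _).bddAbove]
  exact forall_congr' fun z => by norm_cast

/-- The tree-width of a finite graph is attained by some tree decomposition. -/
theorem treeWidth_le_iff {V : Type v} [Finite V] (G : SimpleGraph V) (t : ℕ) :
    treeWidth G ≤ t ↔ ∃ (N : Type) (_ : Finite N) (T : SimpleGraph N) (β : N → Set V),
      IsTreeDecomposition G T β ∧ ∀ z, (β z).ncard ≤ t + 1 := by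
  have hbdd : BddBelow {w : ℤ | ∃ (N : Type) (_ : Finite N) (T : SimpleGraph N) (β : N → Set V),
      IsTreeDecomposition G T β ∧ width β = w} := by
    refine ⟨-1, ?_⟩
    rintro w ⟨N, hN, T, β, h, rfl⟩
    obtain ⟨z⟩ := h.isTree.connected.nonempty
    have h1 : ((β z).ncard : ℤ) ≤ ⨆ z : N, ((β z).ncard : ℤ) :=
      le_ciSup (f := fun z : N => ((β z).ncard : ℤ)) (Set.finite_range _).bddAbove z
    unfold width
    omega
  constructor
  · intro h
    have hne : {w : ℤ | ∃ (N : Type) (_ : Finite N) (T : SimpleGraph N) (β : N → Set V),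
        IsTreeDecomposition G T β ∧ width β = w}.Nonempty := by
      refine ⟨_, Unit, inferInstance, ⊥, fun _ => Set.univ, ⟨?_, ?_, ?_⟩, rfl⟩
      · exact IsTree.of_subsingleton
      · exact fun _ _ _ => ⟨(), trivial, trivial⟩
      · intro x
        have : Nonempty {z : Unit | x ∈ (Set.univ : Set V)} := ⟨⟨(), trivial⟩⟩
        exact IsTree.of_subsingleton.connected
    obtain ⟨N, hN, T, β, hd, hw⟩ := Int.csInf_mem hne hbdd
    have := hd.isTree.connected.nonempty
    refine ⟨N, hN, T, β, hd, (width_le_iff β t).1 ?_⟩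
    rw [hw]
    exact h
  · rintro ⟨N, hN, T, β, hd, hw⟩
    have := hd.isTree.connected.nonempty
    exact (csInf_le hbdd ⟨N, hN, T, β, hd, rfl⟩).trans ((width_le_iff β t).2 hw)

/-- A rooted tree decomposition of `G` with bags of size at most `s`, whose nodes other than the
root (with empty bag) are identified with the vertices of `G`: the node `x` is the one that
introduces the vertex `x`. The parent of a child of the root is `none`. -/
structure Layout {V : Type*} (G : SimpleGraph V) (s : ℕ) where
  rank : V → ℕ
  par : V → Option V
  bag : V → Set V
  rank_par : ∀ {x p}, par x = some p → rank p < rank x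
  mem_bag : ∀ x, x ∈ bag x
  mem_bag_par : ∀ {x y}, y ∈ bag x → y ≠ x → ∃ p, par x = some p ∧ y ∈ bag p
  adj : ∀ {x y}, G.Adj x y → x ∈ bag y ∨ y ∈ bag x
  ncard_bag : ∀ x, (bag x).ncard ≤ s

namespace Layout

variable {V : Type*} {G : SimpleGraph V} {s : ℕ}

theorem rank_lt (L : Layout G s) {x y : V} (hy : y ∈ L.bag x) (hyx : y ≠ x) :
    L.rank y < L.rank x := by
  induction hn : L.rank x using Nat.strong_induction_on generalizing x with
  | _ n ih =>
    obtain ⟨p, hp, hyp⟩ := L.mem_bag_par hy hyx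
    have h1 := L.rank_par hp
    by_cases h : y = p
    · subst h; omega
    · have := ih _ (hn ▸ h1) hyp h rfl
      omega

/-- Transport of a layout along a bijection of the vertices. -/
def comap {W : Type*} (L : Layout G s) (e : W ≃ V) : Layout (G.comap e) s where
  rank x := L.rank (e x)
  par x := (L.par (e x)).map e.symm
  bag x := e ⁻¹' L.bag (e x)
  rank_par := by
    intro x p h
    obtain ⟨q, hq, rfl⟩ := Option.map_eq_some_iff.1 h
    simpa using L.rank_par hq
  mem_bag x := L.mem_bag (e x)
  mem_bag_par := by
    intro x y hy hyx
    obtain ⟨p, hp, hyp⟩ := L.mem_bag_par hy (e.injective.ne hyx)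
    exact ⟨e.symm p, by simp [hp], by simpa using hyp⟩
  adj h := L.adj h
  ncard_bag x := by
    rw [Set.ncard_preimage_of_injective_subset_range e.injective (by simp)]
    exact L.ncard_bag (e x)

/-- The nodes of the tree are the vertices, numbered by `Fin n`, and an additional root `none`. -/
theorem treeWidth_le [Finite V] {t : ℕ} (L : Layout G (t + 1)) : treeWidth G ≤ t := by
  rw [treeWidth_le_iff]
  obtain ⟨n, ⟨e⟩⟩ := Finite.exists_equiv_fin V
  let par : Option (Fin n) → Option (Fin n) := fun z => z.bind fun i => (L.par (e.symm i)).map e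
  let rank : Option (Fin n) → ℕ := fun z => z.elim 0 fun i => L.rank (e.symm i) + 1
  let bag : Option (Fin n) → Set V := fun z => z.elim ∅ fun i => L.bag (e.symm i)
  let T : SimpleGraph (Option (Fin n)) :=
    SimpleGraph.fromRel fun x y => x ≠ none ∧ par x = y
  have hrank : ∀ x, x ≠ none → rank (par x) < rank x := by
    rintro (_ | i) hx
    · exact absurd rfl hx
    · cases hp : L.par (e.symm i) with
      | none => simp [par, rank, hp]
      | some p => simpa [par, rank, hp] using L.rank_par hp
  have hT : ∀ x y, T.Adj x y ↔ (x ≠ none ∧ par x = y) ∨ (y ≠ none ∧ par y = x) := by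
    intro x y
    rw [SimpleGraph.fromRel_adj, and_iff_right_iff_imp]
    rintro (⟨hx, rfl⟩ | ⟨hy, rfl⟩) h
    · have := hrank x hx
      rw [← h] at this
      exact lt_irrefl _ this
    · have := hrank y hy
      rw [h] at this
      exact lt_irrefl _ this
  refine ⟨Option (Fin n), inferInstance, T, bag, ⟨?_, ?_, ?_⟩, ?_⟩
  · exact isTree_of_parent T none par rank hrank hT
  · intro x y hxy
    rcases L.adj hxy with h | h
    · exact ⟨some (e y), by simpa [bag] using h, by simpa [bag] using L.mem_bag y⟩
    · exact ⟨some (e x), by simpa [bag] using L.mem_bag x, by simpa [bag] using h⟩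
  · intro x
    refine connected_induce_of_parent T none par rank hrank hT _ (some (e x)) ?_ ?_
    · simpa [bag] using L.mem_bag x
    · rintro (_ | i) hz hne
      · exact absurd hz (by simp [bag])
      · refine ⟨by simp, ?_⟩
        obtain ⟨p, hp, hxp⟩ := L.mem_bag_par (x := e.symm i) (y := x) hz
          (by rintro rfl; simp at hne)
        simpa [par, bag, hp] using hxp
  · rintro (_ | i)
    · simp [bag]
    · exact L.ncard_bag _

/-- Colors are chosen in the order of increasing rank: at that time the neighbors of `x` that
already have a color lie in the bag of `x`. -/
theorem colorable [Finite V] (L : Layout G s) : G.Colorable s := by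
  have key : ∀ n : ℕ, ∃ f : V → Fin s,
      ∀ x y, x ∈ L.bag y → x ≠ y → L.rank y < n → f x ≠ f y := by
    intro n
    induction n with
    | zero =>
      have hs : ∀ x : V, 0 < s := fun x => by
        have h1 : 0 < (L.bag x).ncard :=
          (Set.ncard_pos (Set.toFinite _)).2 ⟨x, L.mem_bag x⟩
        exact h1.trans_le (L.ncard_bag x)
      exact ⟨fun x => ⟨0, hs x⟩, fun _ _ _ _ h => absurd h (Nat.not_lt_zero _)⟩
    | succ n ih =>
      obtain ⟨f, hf⟩ := ih
      have hfree : ∀ y, ∃ a : Fin s, ∀ x ∈ L.bag y, x ≠ y → f x ≠ a := by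
        intro y
        by_contra! hcon
        have h1 : (Set.univ : Set (Fin s)) ⊆ f '' (L.bag y \ {y}) := by
          intro a _
          obtain ⟨x, hx, hxy, hxa⟩ := hcon a
          exact ⟨x, ⟨hx, hxy⟩, hxa⟩
        have h2 := (Set.ncard_le_ncard h1 (Set.toFinite _)).trans
          (Set.ncard_image_le (Set.toFinite _))
        have h3 := Set.ncard_sdiff_singleton_lt_of_mem (L.mem_bag y)
        rw [Set.ncard_univ, Nat.card_fin] at h2
        have := L.ncard_bag y
        omega
      choose g hg using hfree
      refine ⟨fun y => if L.rank y = n then g y else f y, ?_⟩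
      intro x y hx hxy hy
      have hlt := L.rank_lt hx hxy
      have hxn : L.rank x ≠ n := by omega
      simp only [hxn, if_false]
      split_ifs with h
      · exact hg y x hx hxy
      · exact hf x y hx hxy (by omega)
  obtain ⟨m, hm⟩ := (Set.finite_range L.rank).bddAbove
  obtain ⟨f, hf⟩ := key (m + 1)
  have hlt : ∀ x, L.rank x < m + 1 := fun x => Nat.lt_succ_of_le (hm ⟨x, rfl⟩)
  refine ⟨Coloring.mk f ?_⟩
  intro x y hxy
  rcases L.adj hxy with h | h
  · exact hf x y h hxy.ne (hlt y)
  · exact (hf y x h hxy.ne' (hlt x)).symm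

/-- The vertices are ordered by the distance of the top nodes of their subtrees from a root, ties
being broken arbitrarily. The bag of `x` consists of the vertices before `x` whose subtrees contain
the top node of the subtree of `x`, and the parent of `x` is the last one among them. -/
theorem exists_of_treeWidth_le [Finite V] {t : ℕ} (h : treeWidth G ≤ t) :
    Nonempty (Layout G (t + 1)) := by
  classical
  obtain ⟨N, hN, T, β, hd, hβ⟩ := (treeWidth_le_iff G t).1 h
  obtain ⟨r⟩ := hd.isTree.connected.nonempty
  have htop : ∀ x : V, ∃ a, x ∈ β a ∧ ∀ z, x ∈ β z → T.dist a r ≤ T.dist z r := by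
    intro x
    obtain ⟨⟨z, hz⟩⟩ := (hd.connected x).nonempty
    obtain ⟨a, ha, ha'⟩ := Set.exists_min_image {z : N | x ∈ β z} (fun z => T.dist z r)
      (Set.toFinite _) ⟨z, hz⟩
    exact ⟨a, ha, ha'⟩
  choose top htop_mem htop_min using htop
  obtain ⟨n, ⟨e⟩⟩ := Finite.exists_equiv_fin V
  -- As `e x < n`, this orders the vertices lexicographically by distance and number.
  let rank : V → ℕ := fun x => T.dist (top x) r * n + e x
  have hrank_dist : ∀ {x y}, rank x ≤ rank y → T.dist (top x) r ≤ T.dist (top y) r := by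
    intro x y hxy
    have h1 : T.dist (top x) r * n < (T.dist (top y) r + 1) * n := by
      have := (e y).2
      simp only [rank] at hxy
      rw [add_mul]
      omega
    exact Nat.lt_succ_iff.1 (Nat.lt_of_mul_lt_mul_right h1)
  have hrank_inj : ∀ {x y}, rank x = rank y → x = y := by
    intro x y hxy
    have h1 := le_antisymm (hrank_dist hxy.le) (hrank_dist hxy.ge)
    simp only [rank, h1] at hxy
    exact e.injective (Fin.ext (by omega))
  have hmem : ∀ {x y z}, rank x ≤ rank y → x ∈ β z → y ∈ β z → x ∈ β (top y) := by
    intro x y z hxy hx hy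
    exact top_mem_of_inter hd.isTree (hd.connected x) (hd.connected y) (htop_mem x) (htop_min x)
      (htop_mem y) (htop_min y) (hrank_dist hxy) z hx hy
  let bag : V → Set V := fun x => {y | rank y ≤ rank x ∧ y ∈ β (top x)}
  have hpar : ∀ x, ∃ p : Option V, (∀ q, p = some q → q ∈ bag x ∧ q ≠ x) ∧
      ∀ y ∈ bag x, y ≠ x → ∃ q, p = some q ∧ rank y ≤ rank q := by
    intro x
    by_cases hne : (bag x \ {x}).Nonempty
    · obtain ⟨q, hq, hq'⟩ := Set.exists_max_image (bag x \ {x}) rank (Set.toFinite _) hne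
      refine ⟨some q, ?_, fun y hy hyx => ⟨q, rfl, hq' y ⟨hy, hyx⟩⟩⟩
      rintro q' ⟨⟩
      exact hq
    · exact ⟨none, by simp, fun y hy hyx => absurd ⟨y, hy, hyx⟩ hne⟩
  choose par hpar_mem hpar_max using hpar
  refine ⟨⟨rank, par, bag, ?_, fun x => ⟨le_rfl, htop_mem x⟩, ?_, ?_, ?_⟩⟩
  · intro x p hp
    obtain ⟨h1, h2⟩ := hpar_mem x p hp
    exact lt_of_le_of_ne h1.1 fun h => h2 (hrank_inj h)
  · intro x y hy hyx
    obtain ⟨q, hq, hyq⟩ := hpar_max x y hy hyx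
    exact ⟨q, hq, hyq, hmem hyq hy.2 (hpar_mem x q hq).1.2⟩
  · intro x y hxy
    obtain ⟨z, hx, hy⟩ := hd.exists_bag_of_adj x y hxy
    rcases le_total (rank x) (rank y) with h1 | h1
    · exact Or.inl ⟨h1, hmem h1 hx hy⟩
    · exact Or.inr ⟨h1, hmem h1 hy hx⟩
  · intro x
    exact (Set.ncard_le_ncard (fun y hy => hy.2) (Set.toFinite _)).trans (hβ (top x))

end Layout

/-! ### Cliques -/

theorem cliqueFree_iff_forall_fin {V : Type*} (G : SimpleGraph V) (k : ℕ) :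
    G.CliqueFree k ↔ ¬ ∃ f : Fin k → V, ∀ i j, i ≠ j → G.Adj (f i) (f j) := by
  rw [← not_iff_not, not_cliqueFree_iff_top_isContained, not_not]
  constructor
  · rintro ⟨f⟩
    exact ⟨f, fun i j h => f.toHom.map_adj h⟩
  · rintro ⟨f, hf⟩
    refine ⟨⟨⟨f, fun h => hf _ _ h⟩, fun i j hij => ?_⟩⟩
    by_contra hne
    have := hf i j hne
    rw [show f i = f j from hij] at this
    exact G.irrefl this

theorem cliqueFree_of_hom {V W : Type*} {G : SimpleGraph V} {H : SimpleGraph W} {k : ℕ}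
    (f : G →g H) (h : H.CliqueFree k) : G.CliqueFree k := by
  rw [cliqueFree_iff_forall_fin] at h ⊢
  rintro ⟨g, hg⟩
  exact h ⟨fun i => f (g i), fun i j hij => f.map_adj (hg i j hij)⟩

/-! ### Nice path decompositions -/

theorem mem_of_connected_induce_pathGraph {n : ℕ} {X : Set (Fin (n + 1))}
    (h : ((pathGraph (n + 1)).induce X).Connected) {i j l : Fin (n + 1)} (hij : i ≤ j)
    (hjl : j ≤ l) (hi : i ∈ X) (hl : l ∈ X) : j ∈ X := by
  by_contra hj
  have key : ∀ w : X, ((pathGraph (n + 1)).induce X).Reachable ⟨i, hi⟩ w →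
      (w : Fin (n + 1)) < j := by
    intro w hw
    rw [reachable_iff_reflTransGen] at hw
    induction hw with
    | refl => exact lt_of_le_of_ne hij fun h => hj (h ▸ hi)
    | @tail b c _ hbc ih =>
      have hc : (c : Fin (n + 1)) ≠ j := fun h => hj (h ▸ c.2)
      have h1 : (b : Fin (n + 1)).val + 1 = (c : Fin (n + 1)).val ∨
          (c : Fin (n + 1)).val + 1 = (b : Fin (n + 1)).val := pathGraph_adj.1 hbc
      rw [Fin.lt_def] at ih ⊢
      have := Fin.val_ne_of_ne hc
      omega
  exact absurd (key ⟨l, hl⟩ (h.preconnected _ _)) (not_lt.2 hjl)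

theorem pathGraph_adj_iff_pred {n : ℕ} (x y : Fin (n + 1)) : (pathGraph (n + 1)).Adj x y ↔
    (x ≠ 0 ∧ (⟨x.val - 1, by omega⟩ : Fin (n + 1)) = y) ∨
      (y ≠ 0 ∧ (⟨y.val - 1, by omega⟩ : Fin (n + 1)) = x) := by
  rw [pathGraph_adj]
  simp only [Fin.ext_iff, ne_eq, Fin.val_zero]
  omega

theorem pathGraph_isTree (n : ℕ) : (pathGraph (n + 1)).IsTree := by
  refine isTree_of_parent _ 0 (fun x => ⟨x.val - 1, by omega⟩) Fin.val ?_ pathGraph_adj_iff_pred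
  intro x hx
  have := Fin.val_ne_of_ne hx
  simp only [Fin.val_zero] at this
  simp only
  omega

theorem connected_induce_pathGraph {n : ℕ} {X : Set (Fin (n + 1))} (hne : X.Nonempty)
    (h : ∀ i j l : Fin (n + 1), i ≤ j → j ≤ l → i ∈ X → l ∈ X → j ∈ X) :
    ((pathGraph (n + 1)).induce X).Connected := by
  obtain ⟨q, hq, hmin⟩ := Set.exists_min_image X id (Set.toFinite _) hne
  refine connected_induce_of_parent _ 0 (fun x => ⟨x.val - 1, by omega⟩) Fin.val ?_
    pathGraph_adj_iff_pred X q hq ?_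
  · intro x hx
    have := Fin.val_ne_of_ne hx
    simp only [Fin.val_zero] at this
    simp only
    omega
  · intro x hx hxq
    have h1 : q < x := lt_of_le_of_ne (hmin x hx) hxq.symm
    have h2 : q.val < x.val := h1
    refine ⟨?_, h q _ x ?_ ?_ hq hx⟩
    · rintro rfl
      simp at h2
    · rw [Fin.le_def]; simp only; omega
    · rw [Fin.le_def]; simp only; omega

namespace PathPresentation

variable {U : Type u} {P : PathPresentation U}

theorem ext_of_bag {P Q : PathPresentation U} (hg : P.graph = Q.graph) (hn : P.n = Q.n)
    (hb : ∀ (i : ℕ) (h : i < P.n + 1) (h' : i < Q.n + 1), P.bag ⟨i, h⟩ = Q.bag ⟨i, h'⟩) :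
    P = Q := by
  obtain ⟨g, n, b⟩ := P
  obtain ⟨g', n', b'⟩ := Q
  simp only at hg hn hb
  subst hg hn
  congr
  funext i
  exact hb i i.2 i.2

theorem isNice_iff (P : PathPresentation U) : P.IsNice ↔
    (∀ z, P.bag z ⊆ P.graph.verts) ∧ (∀ x ∈ P.graph.verts, ∃ z, x ∈ P.bag z) ∧
    (∀ x y, P.graph.Adj x y → ∃ z, x ∈ P.bag z ∧ y ∈ P.bag z) ∧
    (∀ x i j l, i ≤ j → j ≤ l → x ∈ P.bag i → x ∈ P.bag l → x ∈ P.bag j) ∧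
    P.bag 0 = ∅ ∧ ∀ i, (P.new i).ncard = 1 := by
  constructor
  · intro h
    refine ⟨h.bag_subset, ?_, ?_, ?_, h.bag_zero, h.ncard_new⟩
    · intro x hx
      obtain ⟨⟨z, hz⟩⟩ := (h.isPathDecomposition.connected ⟨x, hx⟩).nonempty
      exact ⟨z, hz⟩
    · intro x y hxy
      exact h.isPathDecomposition.exists_bag_of_adj ⟨x, P.graph.edge_vert hxy⟩
        ⟨y, P.graph.edge_vert hxy.symm⟩ hxy
    · intro x i j l hij hjl hi hl
      exact mem_of_connected_induce_pathGraph
        (h.isPathDecomposition.connected ⟨x, h.bag_subset _ hi⟩) hij hjl hi hl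
  · rintro ⟨h1, h2, h3, h4, h5, h6⟩
    refine ⟨h1, ⟨pathGraph_isTree _, fun x y hxy => h3 x y hxy, ?_⟩, h5, h6⟩
    rintro ⟨x, hx⟩
    exact connected_induce_pathGraph (h2 x hx) (h4 x)

namespace IsNice

theorem exists_mem_bag (h : P.IsNice) {x : U} (hx : x ∈ P.graph.verts) : ∃ z, x ∈ P.bag z :=
  ((isNice_iff P).1 h).2.1 x hx

theorem exists_bag_of_adj (h : P.IsNice) {x y : U} (hxy : P.graph.Adj x y) :
    ∃ z, x ∈ P.bag z ∧ y ∈ P.bag z :=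
  ((isNice_iff P).1 h).2.2.1 x y hxy

theorem mem_bag_of_le (h : P.IsNice) {x : U} {i j l : Fin (P.n + 1)} (hij : i ≤ j) (hjl : j ≤ l)
    (hi : x ∈ P.bag i) (hl : x ∈ P.bag l) : x ∈ P.bag j :=
  ((isNice_iff P).1 h).2.2.2.1 x i j l hij hjl hi hl

theorem lt_of_mem_new (h : P.IsNice) {x : U} {i : Fin P.n} {z : Fin (P.n + 1)}
    (hx : x ∈ P.new i) (hz : x ∈ P.bag z) : i.val < z.val := by
  by_contra hcon
  refine hx.2 (h.mem_bag_of_le (i := z) (l := i.succ) ?_ ?_ hz hx.1)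
  · rw [Fin.le_def, Fin.val_castSucc]; omega
  · rw [Fin.le_def, Fin.val_castSucc, Fin.val_succ]; omega

/-- Once introduced, a vertex stays in the bags until it disappears for good. -/
theorem mem_bag_of_mem_new (h : P.IsNice) {x : U} {i : Fin P.n} {j z : Fin (P.n + 1)}
    (hx : x ∈ P.new i) (hz : x ∈ P.bag z) (hij : i.val < j.val) (hjz : j ≤ z) : x ∈ P.bag j :=
  h.mem_bag_of_le (i := i.succ) (by rw [Fin.le_def, Fin.val_succ]; omega) hjz hx.1 hz

theorem exists_mem_new (h : P.IsNice) {x : U} (hx : x ∈ P.graph.verts) : ∃ i, x ∈ P.new i := by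
  obtain ⟨z, hz, hmin⟩ := Set.exists_min_image {z | x ∈ P.bag z} id (Set.toFinite _)
    (h.exists_mem_bag hx)
  have hz0 : z ≠ 0 := by
    rintro rfl
    have hz' : x ∈ P.bag 0 := hz
    rw [h.bag_zero] at hz'
    exact hz'
  obtain ⟨i, rfl⟩ := Fin.exists_succ_eq.2 hz0
  refine ⟨i, hz, fun hi => ?_⟩
  have := hmin _ hi
  rw [id, id, Fin.le_def, Fin.val_castSucc, Fin.val_succ] at this
  omega

theorem new_unique (h : P.IsNice) {x : U} {i j : Fin P.n} (hi : x ∈ P.new i) (hj : x ∈ P.new j) :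
    i = j := by
  have h1 := h.lt_of_mem_new hi hj.1
  have h2 := h.lt_of_mem_new hj hi.1
  rw [Fin.val_succ] at h1 h2
  exact Fin.ext (by omega)

theorem eq_of_mem_new (h : P.IsNice) {x y : U} {i : Fin P.n} (hx : x ∈ P.new i)
    (hy : y ∈ P.new i) : x = y := by
  obtain ⟨a, ha⟩ := Set.ncard_eq_one.1 (h.ncard_new i)
  rw [ha] at hx hy
  exact hx.trans hy.symm

theorem new_nonempty (h : P.IsNice) (i : Fin P.n) : ∃ x, x ∈ P.new i := by
  obtain ⟨a, ha⟩ := Set.ncard_eq_one.1 (h.ncard_new i)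
  exact ⟨a, ha ▸ rfl⟩

theorem finite_verts (h : P.IsNice) : P.graph.verts.Finite := by
  have hsub : P.graph.verts ⊆ ⋃ i, P.new i := fun x hx => Set.mem_iUnion.2 (h.exists_mem_new hx)
  refine (Set.finite_iUnion fun i => ?_).subset hsub
  exact Set.finite_of_ncard_ne_zero (by rw [h.ncard_new i]; exact one_ne_zero)

end IsNice

theorem new_upTo (P : PathPresentation U) (i : Fin P.n) (j : Fin (i + 1)) :
    (P.upTo i).new j = P.new ⟨j, by omega⟩ := rfl

theorem mem_verts_upTo {i : Fin P.n} {x : U} : x ∈ (P.upTo i).graph.verts ↔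
    x ∈ P.graph.verts ∧ ∀ j, i < j → x ∉ P.new j := by
  simp only [upTo, Subgraph.deleteVerts_verts, Set.mem_sdiff, Set.mem_ofPred_eq]
  push Not
  rfl

theorem adj_upTo {i : Fin P.n} {x y : U} : (P.upTo i).graph.Adj x y ↔
    x ∈ (P.upTo i).graph.verts ∧ y ∈ (P.upTo i).graph.verts ∧ P.graph.Adj x y := by
  simp only [upTo, Subgraph.deleteVerts_adj, Subgraph.deleteVerts_verts, Set.mem_sdiff]
  tauto

theorem IsNice.mem_verts_upTo_of_mem_new (h : P.IsNice) {i j : Fin P.n} (hji : j ≤ i) {x : U}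
    (hx : x ∈ P.new j) : x ∈ (P.upTo i).graph.verts := by
  refine mem_verts_upTo.2 ⟨h.bag_subset _ hx.1, fun l hl hxl => ?_⟩
  rw [h.new_unique hx hxl] at hji
  exact absurd hji (not_le.2 hl)

theorem IsNice.exists_mem_new_of_mem_verts_upTo (h : P.IsNice) {i : Fin P.n} {x : U}
    (hx : x ∈ (P.upTo i).graph.verts) : ∃ j, j ≤ i ∧ x ∈ P.new j := by
  obtain ⟨j, hj⟩ := h.exists_mem_new (mem_verts_upTo.1 hx).1
  exact ⟨j, not_lt.1 fun hij => (mem_verts_upTo.1 hx).2 j hij hj, hj⟩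

theorem IsNice.upTo (h : P.IsNice) (i : Fin P.n) : (P.upTo i).IsNice := by
  rw [isNice_iff]
  refine ⟨?_, ?_, ?_, ?_, h.bag_zero, fun j => ?_⟩
  · intro z x hx
    refine mem_verts_upTo.2 ⟨h.bag_subset _ hx, fun j hij hj => ?_⟩
    have h1 := h.lt_of_mem_new hj hx
    change j.val < z.val at h1
    have h2 : z.val < i.val + 1 + 1 := z.2
    rw [Fin.lt_def] at hij
    omega
  · intro x hx
    obtain ⟨j, hji, hj⟩ := h.exists_mem_new_of_mem_verts_upTo hx
    exact ⟨⟨j + 1, Nat.succ_lt_succ (Nat.lt_succ_of_le hji)⟩, hj.1⟩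
  · intro x y hxy
    obtain ⟨hx, hy, hxy⟩ := adj_upTo.1 hxy
    obtain ⟨z, hxz, hyz⟩ := h.exists_bag_of_adj hxy
    by_cases hz : z.val < i.val + 1 + 1
    · exact ⟨⟨z, hz⟩, hxz, hyz⟩
    · obtain ⟨a, hai, ha⟩ := h.exists_mem_new_of_mem_verts_upTo hx
      obtain ⟨b, hbi, hb⟩ := h.exists_mem_new_of_mem_verts_upTo hy
      rw [Fin.le_def] at hai hbi
      have hiz : i.succ ≤ z := by rw [Fin.le_def, Fin.val_succ]; omega
      exact ⟨⟨i + 1, Nat.lt_succ_self _⟩,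
        h.mem_bag_of_mem_new (j := i.succ) ha hxz (by rw [Fin.val_succ]; omega) hiz,
        h.mem_bag_of_mem_new (j := i.succ) hb hyz (by rw [Fin.val_succ]; omega) hiz⟩
  · intro x a b c hab hbc ha hc
    exact h.mem_bag_of_le (P := P) (i := Fin.castLE _ a) (l := Fin.castLE _ c) hab hbc ha hc
  · rw [new_upTo P i j]
    exact h.ncard_new _

theorem upTo_upTo (P : PathPresentation U) (i : Fin P.n) (j : Fin (i + 1)) :
    (P.upTo i).upTo j = P.upTo ⟨j, by omega⟩ := by
  refine ext_of_bag ?_ rfl fun _ _ _ => rfl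
  change (P.graph.deleteVerts _).deleteVerts _ = P.graph.deleteVerts _
  rw [Subgraph.deleteVerts_deleteVerts]
  congr 1
  ext x
  constructor
  · rintro (⟨l, hl, hx⟩ | ⟨l, hl, hx⟩)
    · refine ⟨l, ?_, hx⟩
      rw [Fin.lt_def] at hl ⊢
      simp only
      omega
    · have hl2 : l.val < i.val + 1 := l.2
      exact ⟨⟨l, by omega⟩, hl, hx⟩
  · rintro ⟨l, hl, hx⟩
    by_cases hli : i < l
    · exact Or.inl ⟨l, hli, hx⟩
    · exact Or.inr ⟨⟨l, Nat.lt_succ_of_le (not_lt.1 hli)⟩, hl, hx⟩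

theorem upTo_eq_self (P : PathPresentation U) (i : Fin P.n) (hi : i.val + 1 = P.n) :
    P.upTo i = P := by
  refine ext_of_bag ?_ hi fun _ _ _ => rfl
  change P.graph.deleteVerts _ = P.graph
  convert Subgraph.deleteVerts_empty
  ext x
  simp only [Set.mem_ofPred_eq, Set.mem_empty_iff_false, iff_false, not_exists, not_and]
  intro j hj
  rw [Fin.lt_def] at hj
  omega

theorem graph_upTo_le (P : PathPresentation U) (i : Fin P.n) : (P.upTo i).graph ≤ P.graph :=
  Subgraph.deleteVerts_le

theorem cliqueFree_iff (P : PathPresentation U) {k : ℕ} (hk : 0 < k) : P.graph.coe.CliqueFree k ↔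
    ¬ ∃ f : Fin k → U, f ⟨0, hk⟩ ∈ P.graph.verts ∧
      ∀ i j, i ≠ j → P.graph.Adj (f i) (f j) := by
  rw [cliqueFree_iff_forall_fin, not_iff_not]
  constructor
  · rintro ⟨f, hf⟩
    exact ⟨fun i => f i, (f _).2, hf⟩
  · rintro ⟨f, h0, hf⟩
    have hmem : ∀ i, f i ∈ P.graph.verts := by
      intro i
      by_cases hi : i = ⟨0, hk⟩
      · exact hi ▸ h0
      · exact P.graph.edge_vert (hf _ _ hi)
    exact ⟨fun i => ⟨f i, hmem i⟩, hf⟩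

/-- The presentations that the competitive bounds refer to: nice path decompositions of width at
most `t` of `K_k`-free graphs. -/
structure Admissible (t k : ℕ) (P : PathPresentation U) : Prop where
  isNice : P.IsNice
  cliqueFree : P.graph.coe.CliqueFree k
  width_le : width P.bag ≤ t

theorem Admissible.upTo {t k : ℕ} (h : P.Admissible t k) (i : Fin P.n) :
    (P.upTo i).Admissible t k where
  isNice := h.isNice.upTo i
  cliqueFree := cliqueFree_of_hom (Subgraph.inclusion (P.graph_upTo_le i)) h.cliqueFree
  width_le := (width_le_iff _ t).2 fun _ => (width_le_iff _ t).1 h.width_le _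

/-- One more step of a presentation: the new vertex `x` is joined to the vertices of `nb`, and the
next bag is `b`. -/
def snoc (P : PathPresentation U) (x : U) (b nb : Set U) : PathPresentation U where
  graph :=
    { verts := insert x P.graph.verts
      Adj := fun a c => P.graph.Adj a c ∨ (a = x ∧ c ≠ x ∧ c ∈ nb ∧ c ∈ P.graph.verts) ∨
        (c = x ∧ a ≠ x ∧ a ∈ nb ∧ a ∈ P.graph.verts)
      adj_sub := by
        rintro a c (h | ⟨rfl, h, -⟩ | ⟨rfl, h, -⟩)
        · exact P.graph.adj_sub h
        · exact h.symm
        · exact h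
      edge_vert := by
        rintro a c (h | ⟨rfl, -⟩ | ⟨-, -, -, h⟩)
        · exact Or.inr (P.graph.edge_vert h)
        · exact Or.inl rfl
        · exact Or.inr h
      symm := by
        constructor
        rintro a c (h | h | h)
        · exact Or.inl h.symm
        · exact Or.inr (Or.inr h)
        · exact Or.inr (Or.inl h) }
  n := P.n + 1
  bag := fun z => if h : z.val < P.n + 1 then P.bag ⟨z, h⟩ else b

section snoc

variable {x : U} {b nb : Set U}

theorem bag_snoc_of_lt {z : Fin ((P.snoc x b nb).n + 1)} (h : z.val < P.n + 1) :
    (P.snoc x b nb).bag z = P.bag ⟨z, h⟩ := dif_pos h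

theorem bag_snoc_of_not_lt {z : Fin ((P.snoc x b nb).n + 1)} (h : ¬ z.val < P.n + 1) :
    (P.snoc x b nb).bag z = b := dif_neg h

theorem new_snoc_of_lt {i : Fin (P.snoc x b nb).n} (h : i.val < P.n) :
    (P.snoc x b nb).new i = P.new ⟨i, h⟩ := by
  unfold new
  rw [bag_snoc_of_lt (z := i.succ) (by rw [Fin.val_succ]; omega),
    bag_snoc_of_lt (z := i.castSucc) (by rw [Fin.val_castSucc]; omega)]
  rfl

theorem new_snoc_of_not_lt (hx : x ∉ P.bag (Fin.last _)) (hxb : x ∈ b)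
    (hb : b ⊆ insert x (P.bag (Fin.last _))) {i : Fin (P.snoc x b nb).n} (h : ¬ i.val < P.n) :
    (P.snoc x b nb).new i = {x} := by
  have hi : i.val < P.n + 1 := i.2
  have hin : i.val = P.n := by omega
  unfold new
  rw [bag_snoc_of_not_lt (z := i.succ) (by rw [Fin.val_succ]; omega),
    bag_snoc_of_lt (z := i.castSucc) (by rw [Fin.val_castSucc]; omega)]
  have h1 : (⟨i.castSucc.val, by rw [Fin.val_castSucc]; omega⟩ : Fin (P.n + 1)) = Fin.last _ :=
    Fin.ext hin
  rw [h1]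
  ext y
  constructor
  · rintro ⟨hy, hy'⟩
    exact (hb hy).resolve_right hy'
  · rintro rfl
    exact ⟨hxb, hx⟩

theorem IsNice.snoc (h : P.IsNice) (hx : x ∉ P.graph.verts) (hxb : x ∈ b)
    (hb : b ⊆ insert x (P.bag (Fin.last _))) (hnb : nb ⊆ b) : (P.snoc x b nb).IsNice := by
  have hxl : x ∉ P.bag (Fin.last _) := fun h' => hx (h.bag_subset _ h')
  have hlast : ¬ (Fin.last (P.n + 1)).val < P.n + 1 := by simp
  rw [isNice_iff]
  refine ⟨?_, ?_, ?_, ?_, ?_, ?_⟩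
  · intro z y hy
    by_cases hz : z.val < P.n + 1
    · rw [bag_snoc_of_lt hz] at hy
      exact Or.inr (h.bag_subset _ hy)
    · rw [bag_snoc_of_not_lt hz] at hy
      exact (hb hy).imp id fun hy => h.bag_subset _ hy
  · rintro y (rfl | hy)
    · exact ⟨Fin.last (P.n + 1), by rwa [bag_snoc_of_not_lt hlast]⟩
    · obtain ⟨z, hz⟩ := h.exists_mem_bag hy
      refine ⟨⟨z.val, Nat.lt_succ_of_lt z.2⟩, ?_⟩
      rwa [bag_snoc_of_lt (z := ⟨z.val, Nat.lt_succ_of_lt z.2⟩) z.2]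
  · rintro y w (hyw | ⟨rfl, -, hw, -⟩ | ⟨rfl, -, hy, -⟩)
    · obtain ⟨z, hz⟩ := h.exists_bag_of_adj hyw
      refine ⟨⟨z.val, Nat.lt_succ_of_lt z.2⟩, ?_⟩
      rwa [bag_snoc_of_lt (z := ⟨z.val, Nat.lt_succ_of_lt z.2⟩) z.2]
    · exact ⟨Fin.last (P.n + 1), by rw [bag_snoc_of_not_lt hlast]; exact ⟨hxb, hnb hw⟩⟩
    · exact ⟨Fin.last (P.n + 1), by rw [bag_snoc_of_not_lt hlast]; exact ⟨hnb hy, hxb⟩⟩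
  · intro y i j l hij hjl hi hl
    rw [Fin.le_def] at hij hjl
    by_cases hln : l.val < P.n + 1
    · rw [bag_snoc_of_lt (by omega)] at hi hl ⊢
      exact h.mem_bag_of_le hij hjl hi hl
    · by_cases hjn : j.val < P.n + 1
      · rw [bag_snoc_of_lt (by omega)] at hi
        rw [bag_snoc_of_not_lt hln] at hl
        rw [bag_snoc_of_lt hjn]
        have hyx : y ≠ x := by
          rintro rfl
          exact hx (h.bag_subset _ hi)
        exact h.mem_bag_of_le (j := ⟨j, hjn⟩) hij (Fin.le_last _) hi ((hb hl).resolve_left hyx)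
      · rwa [bag_snoc_of_not_lt hjn, ← bag_snoc_of_not_lt hln]
  · rw [bag_snoc_of_lt (by simp)]
    exact h.bag_zero
  · intro i
    by_cases hi : i.val < P.n
    · rw [new_snoc_of_lt hi]
      exact h.ncard_new _
    · rw [new_snoc_of_not_lt hxl hxb hb hi, Set.ncard_singleton]

theorem upTo_snoc (h : P.IsNice) (hx : x ∉ P.graph.verts) (hxb : x ∈ b)
    (hb : b ⊆ insert x (P.bag (Fin.last _))) (i : Fin P.n) :
    (P.snoc x b nb).upTo ⟨i, Nat.lt_succ_of_lt i.2⟩ = P.upTo i := by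
  have hxl : x ∉ P.bag (Fin.last _) := fun h' => hx (h.bag_subset _ h')
  have hn : ∀ y, y ∈ P.graph.verts → ((∀ j : Fin (P.snoc x b nb).n,
      (⟨i, Nat.lt_succ_of_lt i.2⟩ : Fin (P.n + 1)) < j → y ∉ (P.snoc x b nb).new j) ↔
      ∀ j, i < j → y ∉ P.new j) := by
    intro y hy
    constructor
    · intro hall j hij hyj
      refine hall ⟨j, Nat.lt_succ_of_lt j.2⟩ hij ?_
      rwa [new_snoc_of_lt (i := ⟨j, Nat.lt_succ_of_lt j.2⟩) j.2]
    · intro hall j hij hyj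
      by_cases hj : j.val < P.n
      · rw [new_snoc_of_lt hj] at hyj
        exact hall _ hij hyj
      · rw [new_snoc_of_not_lt hxl hxb hb hj] at hyj
        exact hx (hyj ▸ hy)
  have hverts : ∀ y, y ∈ ((P.snoc x b nb).upTo ⟨i, Nat.lt_succ_of_lt i.2⟩).graph.verts ↔
      y ∈ (P.upTo i).graph.verts := by
    intro y
    rw [mem_verts_upTo, mem_verts_upTo]
    constructor
    · rintro ⟨rfl | hy, hall⟩
      · refine absurd ?_ (hall ⟨P.n, Nat.lt_succ_self _⟩ i.2)
        rw [new_snoc_of_not_lt hxl hxb hb (i := ⟨P.n, Nat.lt_succ_self _⟩) (lt_irrefl _)]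
        rfl
      · exact ⟨hy, (hn y hy).1 hall⟩
    · rintro ⟨hy, hall⟩
      exact ⟨Or.inr hy, (hn y hy).2 hall⟩
  refine ext_of_bag (Subgraph.ext (Set.ext hverts) ?_) rfl ?_
  · ext y w
    rw [adj_upTo, adj_upTo, hverts, hverts]
    refine and_congr_right fun hy => and_congr_right fun hw => ⟨?_, Or.inl⟩
    rintro (h' | ⟨rfl, -⟩ | ⟨rfl, -⟩)
    · exact h'
    · exact absurd (mem_verts_upTo.1 hy).1 hx
    · exact absurd (mem_verts_upTo.1 hw).1 hx
  · intro z hz hz'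
    exact bag_snoc_of_lt (z := ⟨z, _⟩) (lt_of_lt_of_le hz' (Nat.succ_le_succ i.2))

end snoc

end PathPresentation

/-! ### The universal graph and the on-line algorithm -/

namespace PathPresentation

variable {U : Type u} {P Q R : PathPresentation U} {t k : ℕ}

/-- `P` is what `Q` reveals after one of its steps. -/
def IsPrefix (P Q : PathPresentation U) : Prop := ∃ i : Fin Q.n, P = Q.upTo i

theorem isPrefix_self (h : 0 < P.n) : P.IsPrefix P :=
  ⟨⟨P.n - 1, by omega⟩, (P.upTo_eq_self _ (by simp only; omega)).symm⟩

theorem isPrefix_upTo {i j : Fin P.n} (h : i ≤ j) : (P.upTo i).IsPrefix (P.upTo j) :=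
  ⟨⟨i, Nat.lt_succ_of_le h⟩, (P.upTo_upTo j ⟨i, Nat.lt_succ_of_le h⟩).symm⟩

theorem IsPrefix.graph_le (h : P.IsPrefix Q) : P.graph ≤ Q.graph := by
  obtain ⟨i, rfl⟩ := h
  exact Q.graph_upTo_le i

/-- The vertex introduced in the last step of a presentation with at least one step. -/
noncomputable def lastVertex [Nonempty U] (P : PathPresentation U) : U :=
  Classical.epsilon fun x => ∃ i : Fin P.n, i.val + 1 = P.n ∧ x ∈ P.new i

theorem IsNice.lastVertex_upTo_mem [Nonempty U] (h : P.IsNice) (i : Fin P.n) :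
    (P.upTo i).lastVertex ∈ P.new i := by
  obtain ⟨x, hx⟩ := h.new_nonempty i
  have hex : ∃ x, ∃ j : Fin (P.upTo i).n, j.val + 1 = (P.upTo i).n ∧ x ∈ (P.upTo i).new j :=
    ⟨x, ⟨i, Nat.lt_succ_self _⟩, rfl, hx⟩
  obtain ⟨j, hj, hmem⟩ := Classical.epsilon_spec hex
  have hji : (⟨j.val, by have := j.2; change j.val < i.val + 1 at this; omega⟩ : Fin P.n) = i :=
    Fin.ext (Nat.succ_injective hj)
  rw [new_upTo P i j, hji] at hmem
  exact hmem

theorem IsNice.lastVertex_upTo [Nonempty U] (h : P.IsNice) {i : Fin P.n} {x : U}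
    (hx : x ∈ P.new i) : (P.upTo i).lastVertex = x :=
  h.eq_of_mem_new (h.lastVertex_upTo_mem i) hx

/-- The vertices of the universal graph are the admissible presentations with at least one step.
Each of them stands for the vertex that it introduces last, and two of them are adjacent if one
continues the other and their last vertices are adjacent in the longer one. Sending the vertex
introduced in step `i` to `P.upTo i` maps the graph of every admissible `P` homomorphically to the
universal graph. -/
def universalGraph (U : Type u) [Nonempty U] (t k : ℕ) :
    SimpleGraph {P : PathPresentation U // P.Admissible t k ∧ 0 < P.n} :=
  SimpleGraph.fromRel fun P Q => P.1.IsPrefix Q.1 ∧ P.1.n < Q.1.n ∧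
    Q.1.graph.Adj P.1.lastVertex Q.1.lastVertex

theorem universalGraph_adj [Nonempty U]
    {P Q : {P : PathPresentation U // P.Admissible t k ∧ 0 < P.n}} :
    (universalGraph U t k).Adj P Q ↔
      (P.1.IsPrefix Q.1 ∧ P.1.n < Q.1.n ∧ Q.1.graph.Adj P.1.lastVertex Q.1.lastVertex) ∨
      (Q.1.IsPrefix P.1 ∧ Q.1.n < P.1.n ∧ P.1.graph.Adj Q.1.lastVertex P.1.lastVertex) := by
  unfold universalGraph
  rw [SimpleGraph.fromRel_adj, and_iff_right_iff_imp]
  rintro (⟨-, h, -⟩ | ⟨-, h, -⟩) rfl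
  · exact lt_irrefl _ h
  · exact lt_irrefl _ h

/-- All members of a clique are prefixes of its longest member `Q`, so their last vertices form a
clique in the graph of `Q`. -/
theorem cliqueFree_universalGraph (U : Type u) [Nonempty U] (t : ℕ) {k : ℕ} (hk : 0 < k) :
    (universalGraph U t k).CliqueFree k := by
  rw [cliqueFree_iff_forall_fin]
  rintro ⟨f, hf⟩
  have : Nonempty (Fin k) := ⟨⟨0, hk⟩⟩
  obtain ⟨a, ha⟩ := Finite.exists_max fun i => (f i).1.n
  have hpre : ∀ i, (f i).1.IsPrefix (f a).1 := by
    intro i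
    by_cases hi : i = a
    · rw [hi]
      exact isPrefix_self (f a).2.2
    · rcases universalGraph_adj.1 (hf i a hi) with h | h
      · exact h.1
      · exact absurd h.2.1 (not_lt.2 (ha i))
  refine (cliqueFree_iff _ hk).1 (f a).2.1.cliqueFree ⟨fun i => (f i).1.lastVertex, ?_, ?_⟩
  · obtain ⟨i, hi⟩ := hpre ⟨0, hk⟩
    have hnice := (f a).2.1.isNice
    simp only [hi]
    exact hnice.bag_subset _ (hnice.lastVertex_upTo_mem i).1
  · intro i j hij
    rcases universalGraph_adj.1 (hf i j hij) with h | h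
    · exact (hpre j).graph_le.2 h.2.2
    · exact ((hpre i).graph_le.2 h.2.2).symm

/-- The parent of a presentation is obtained by omitting its last step, and its bag consists of
its prefixes whose last vertices are in its last bag. -/
theorem nonempty_layout_universalGraph [Nonempty U]
    (S : Set {P : PathPresentation U // P.Admissible t k ∧ 0 < P.n})
    (hS : ∀ Q ∈ S, ∀ P, P.1.IsPrefix Q.1 → P ∈ S) :
    Nonempty (Layout ((universalGraph U t k).induce S) (t + 1)) := by
  let par : S → Option S := fun Q =>
    if h : 2 ≤ Q.1.1.n then
      some ⟨⟨Q.1.1.upTo ⟨Q.1.1.n - 2, by omega⟩, Q.1.2.1.upTo _, Nat.succ_pos _⟩,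
        hS Q.1 Q.2 _ ⟨_, rfl⟩⟩
    else none
  let bag : S → Set S := fun Q =>
    {P | P.1.1.IsPrefix Q.1.1 ∧ P.1.1.lastVertex ∈ Q.1.1.bag (Fin.last _)}
  have hadj : ∀ P Q : S, P.1.1.IsPrefix Q.1.1 → P.1.1.n < Q.1.1.n →
      Q.1.1.graph.Adj P.1.1.lastVertex Q.1.1.lastVertex → P ∈ bag Q := by
    intro P Q hPQ _ hadj
    refine ⟨hPQ, ?_⟩
    have hnice := Q.1.2.1.isNice
    obtain ⟨i, hi⟩ := hPQ
    obtain ⟨j, hj⟩ := isPrefix_self Q.1.2.2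
    have h1 := hnice.lastVertex_upTo_mem i
    have h2 := hnice.lastVertex_upTo_mem j
    rw [← hi] at h1
    rw [← hj] at h2
    have hjn : j.val + 1 = Q.1.1.n := (congrArg PathPresentation.n hj).symm
    obtain ⟨z, hz1, hz2⟩ := hnice.exists_bag_of_adj hadj
    -- The last vertex of `Q` lies in no bag but the last one.
    have hz := hnice.lt_of_mem_new h2 hz2
    have hzl : z = Fin.last _ := Fin.ext (by have := z.2; rw [Fin.val_last]; omega)
    exact hzl ▸ hz1
  refine ⟨⟨fun Q => Q.1.1.n, par, bag, ?_, ?_, ?_, ?_, ?_⟩⟩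
  · intro Q P hP
    simp only [par] at hP
    split_ifs at hP with h
    cases hP
    change Q.1.1.n - 2 + 1 < Q.1.1.n
    omega
  · intro Q
    refine ⟨isPrefix_self Q.1.2.2, ?_⟩
    obtain ⟨j, hj⟩ := isPrefix_self Q.1.2.2
    have h2 := Q.1.2.1.isNice.lastVertex_upTo_mem j
    rw [← hj] at h2
    have hjn : j.val + 1 = Q.1.1.n := (congrArg PathPresentation.n hj).symm
    have hjl : j.succ = Fin.last _ := Fin.ext hjn
    exact hjl ▸ h2.1
  · rintro Q P ⟨⟨i, hi⟩, hP⟩ hne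
    have hin : i.val + 1 ≠ Q.1.1.n := by
      intro h
      exact hne (Subtype.ext (Subtype.ext (hi.trans (Q.1.1.upTo_eq_self i h))))
    have h2 : 2 ≤ Q.1.1.n := by omega
    refine ⟨_, dif_pos h2, ?_, ?_⟩
    · change P.1.1.IsPrefix (Q.1.1.upTo ⟨Q.1.1.n - 2, by omega⟩)
      rw [hi]
      exact isPrefix_upTo (by rw [Fin.le_def]; simp only; omega)
    · change P.1.1.lastVertex ∈ Q.1.1.bag (Fin.succ ⟨Q.1.1.n - 2, by omega⟩)
      have h1 := Q.1.2.1.isNice.lastVertex_upTo_mem i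
      rw [← hi] at h1
      exact Q.1.2.1.isNice.mem_bag_of_mem_new h1 hP (by rw [Fin.val_succ]; simp only; omega)
        (Fin.le_last _)
  · intro P Q hPQ
    rcases universalGraph_adj.1 hPQ with ⟨h1, h2, h3⟩ | ⟨h1, h2, h3⟩
    · exact Or.inl (hadj P Q h1 h2 h3)
    · exact Or.inr (hadj Q P h1 h2 h3)
  · intro Q
    have hnice := Q.1.2.1.isNice
    refine le_trans ?_ ((width_le_iff _ t).1 Q.1.2.1.width_le (Fin.last _))
    refine Set.ncard_le_ncard_of_injOn (fun P => P.1.1.lastVertex) (fun P hP => hP.2) ?_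
      (hnice.finite_verts.subset (hnice.bag_subset _))
    rintro P ⟨⟨i, hi⟩, -⟩ P' ⟨⟨j, hj⟩, -⟩ h
    have h1 := hnice.lastVertex_upTo_mem i
    have h2 := hnice.lastVertex_upTo_mem j
    rw [← hi] at h1
    rw [← hj] at h2
    simp only at h
    rw [h] at h1
    have hij := hnice.new_unique h1 h2
    exact Subtype.ext (Subtype.ext (by rw [hi, hj, hij]))

end PathPresentation

/-- A layout determines the tree-width bound and so carries a statement about all finite graphs in
one universe to another universe. -/
theorem Layout.colorable_of_forall {W : Type u} [Finite W] {G : SimpleGraph W} {t k c : ℕ}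
    (hc : ∀ (V : Type v) [Finite V] (H : SimpleGraph V), H.CliqueFree k → treeWidth H ≤ t →
      H.Colorable c) (L : Layout G (t + 1)) (hG : G.CliqueFree k) : G.Colorable c := by
  obtain ⟨n, ⟨e⟩⟩ := Finite.exists_equiv_fin W
  let e' : ULift.{v} (Fin n) ≃ W := Equiv.ulift.trans e.symm
  have h1 : (G.comap e').Colorable c :=
    hc _ _ (cliqueFree_of_hom (⟨e', fun h => h⟩ : G.comap e' →g G) hG) (L.comap e').treeWidth_le
  obtain ⟨C⟩ := h1
  refine ⟨Coloring.mk (fun x => C (e'.symm x)) fun {x y} hxy => C.valid ?_⟩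
  simpa using hxy

namespace PathPresentation

variable {U : Type u} {t k : ℕ}

theorem colorable_universalGraph (U : Type u) [Nonempty U] {t k c : ℕ} (hk : 0 < k)
    (hc : ∀ (V : Type v) [Finite V] (H : SimpleGraph V), H.CliqueFree k → treeWidth H ≤ t →
      H.Colorable c) : (universalGraph U t k).Colorable c := by
  refine SimpleGraph.nonempty_hom_of_forall_finite_subgraph_hom fun G' hG' => Nonempty.some ?_
  let pre : {P : PathPresentation U // P.Admissible t k ∧ 0 < P.n} → Set _ := fun Q =>
    {P : {P : PathPresentation U // P.Admissible t k ∧ 0 < P.n} | P.1.IsPrefix Q.1}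
  have hpre : ∀ Q, (pre Q).Finite := by
    intro Q
    refine (Set.finite_range fun i : Fin Q.1.n =>
      (⟨Q.1.upTo i, Q.2.1.upTo i, Nat.succ_pos _⟩ :
        {P : PathPresentation U // P.Admissible t k ∧ 0 < P.n})).subset ?_
    rintro P ⟨i, hi⟩
    exact ⟨i, Subtype.ext hi.symm⟩
  let S := ⋃ Q ∈ G'.verts, pre Q
  have hSfin : S.Finite := hG'.biUnion fun Q _ => hpre Q
  have hsub : G'.verts ⊆ S := fun Q hQ => Set.mem_biUnion hQ (isPrefix_self Q.2.2)
  have hS : ∀ Q ∈ S, ∀ P, P.1.IsPrefix Q.1 → P ∈ S := by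
    intro Q hQ P hPQ
    obtain ⟨R, hR, hQR⟩ := Set.mem_iUnion₂.1 hQ
    refine Set.mem_biUnion hR ?_
    obtain ⟨i, hi⟩ := hQR
    rw [hi] at hPQ
    obtain ⟨j, hj⟩ := hPQ
    exact ⟨_, hj.trans (R.1.upTo_upTo i j)⟩
  have := hSfin.to_subtype
  obtain ⟨L⟩ := nonempty_layout_universalGraph S hS
  have hcol : ((universalGraph U t k).induce S).Colorable c :=
    L.colorable_of_forall hc (cliqueFree_of_hom
      (⟨Subtype.val, fun h => h⟩ : (universalGraph U t k).induce S →g universalGraph U t k)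
      (cliqueFree_universalGraph U t hk))
  exact ⟨(hcol.some).comp ⟨fun Q => ⟨Q.1, hsub Q.2⟩, fun h => G'.adj_sub h⟩⟩

theorem IsNice.adj_universalGraph [Nonempty U] {P : PathPresentation U} (h : P.IsNice)
    {i j : Fin P.n} (hij : i < j) {x y : U} (hx : x ∈ P.new i) (hy : y ∈ P.new j)
    (hxy : P.graph.Adj x y) (hi : (P.upTo i).Admissible t k) (hj : (P.upTo j).Admissible t k) :
    (universalGraph U t k).Adj ⟨P.upTo i, hi, Nat.succ_pos _⟩ ⟨P.upTo j, hj, Nat.succ_pos _⟩ := by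
  refine universalGraph_adj.2 (Or.inl ⟨isPrefix_upTo hij.le, Nat.succ_lt_succ hij, ?_⟩)
  rw [h.lastVertex_upTo hx, h.lastVertex_upTo hy]
  exact adj_upTo.2 ⟨h.mem_verts_upTo_of_mem_new hij.le hx,
    h.mem_verts_upTo_of_mem_new le_rfl hy, hxy⟩

end PathPresentation

open PathPresentation in
/-- Admissible presentations are colored by a fixed `c`-coloring of the universal graph. The other
ones have no bound to meet; they get new colors, which depend on the number of steps. -/
theorem exists_algorithm (U : Type u) [Nonempty U] {t k c : ℕ} (hk : 0 < k)
    (hc : ∀ (V : Type v) [Finite V] (H : SimpleGraph V), H.CliqueFree k → treeWidth H ≤ t →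
      H.Colorable c) :
    ∃ A : OnlineColoringAlgorithm U, ∀ P : PathPresentation U, P.Admissible t k →
      A.numColors P ≤ c := by
  classical
  obtain ⟨C⟩ := colorable_universalGraph U hk hc
  let color : PathPresentation U → ℤ := fun P =>
    if h : P.Admissible t k ∧ 0 < P.n then ((C ⟨P, h⟩ : ℕ) : ℤ) else c + P.n
  have hpos : ∀ P (h : P.Admissible t k ∧ 0 < P.n), color P = ((C ⟨P, h⟩ : ℕ) : ℤ) :=
    fun P h => dif_pos h
  have hneg : ∀ P (h : ¬ (P.Admissible t k ∧ 0 < P.n)), color P = c + P.n :=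
    fun P h => dif_neg h
  have hlt : ∀ P : PathPresentation U, ∀ i j : Fin P.n, i < j → P.IsNice →
      ∀ x ∈ P.new i, ∀ y ∈ P.new j, P.graph.Adj x y → color (P.upTo i) ≠ color (P.upTo j) := by
    intro P i j hij hP x hx y hy hxy heq
    have hpn : ∀ i : Fin P.n, 0 < (P.upTo i).n := fun i => Nat.succ_pos _
    by_cases hi : (P.upTo i).Admissible t k <;> by_cases hj : (P.upTo j).Admissible t k
    · rw [hpos _ ⟨hi, hpn i⟩, hpos _ ⟨hj, hpn j⟩] at heq
      exact C.valid (hP.adj_universalGraph hij hx hy hxy hi hj)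
        (Fin.ext (by exact_mod_cast heq))
    · rw [hpos _ ⟨hi, hpn i⟩, hneg _ fun h => hj h.1] at heq
      have := (C ⟨P.upTo i, hi, hpn i⟩).2
      omega
    · rw [hneg _ fun h => hi h.1, hpos _ ⟨hj, hpn j⟩] at heq
      have := (C ⟨P.upTo j, hj, hpn j⟩).2
      omega
    · rw [hneg _ fun h => hi h.1, hneg _ fun h => hj h.1] at heq
      change (c : ℤ) + ((i.val + 1 : ℕ) : ℤ) = c + ((j.val + 1 : ℕ) : ℤ) at heq
      rw [Fin.lt_def] at hij
      omega
  refine ⟨⟨color, ?_⟩, ?_⟩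
  · intro P hP i j x hx y hy hxy
    rcases lt_trichotomy i j with h | rfl | h
    · exact hlt P i j h hP x hx y hy hxy
    · exact absurd (hP.eq_of_mem_new hx hy) (P.graph.adj_sub hxy).ne
    · exact (hlt P j i h hP y hy x hx hxy.symm).symm
  · intro P hP
    have hsub : (Set.range fun i : Fin P.n => color (P.upTo i)) ⊆
        Set.range fun a : Fin c => ((a : ℕ) : ℤ) := by
      rintro _ ⟨i, rfl⟩
      exact ⟨_, (hpos _ ⟨hP.upTo i, Nat.succ_pos _⟩).symm⟩
    refine (Set.ncard_le_ncard hsub (Set.toFinite _)).trans ?_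
    rw [← Set.image_univ]
    refine (Set.ncard_image_le (Set.toFinite _)).trans ?_
    rw [Set.ncard_univ, Nat.card_fin]

/-! ### Playing a graph of bounded tree-width against an algorithm -/

namespace PathPresentation

variable {U : Type u} {P P₀ R : PathPresentation U} {t k : ℕ}

theorem IsPrefix.snoc (h : P.IsPrefix R) (hR : R.IsNice) {x : U} {b nb : Set U}
    (hx : x ∉ R.graph.verts) (hxb : x ∈ b) (hb : b ⊆ insert x (R.bag (Fin.last _))) :
    P.IsPrefix (R.snoc x b nb) := by
  obtain ⟨i, rfl⟩ := h
  exact ⟨_, (upTo_snoc hR hx hxb hb i).symm⟩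

theorem IsNice.lastVertex_snoc [Nonempty U] (h : R.IsNice) {x : U} {b nb : Set U}
    (hx : x ∉ R.graph.verts) (hxb : x ∈ b) (hb : b ⊆ insert x (R.bag (Fin.last _)))
    (hnb : nb ⊆ b) : (R.snoc x b nb).lastVertex = x := by
  have hn := h.snoc hx hxb hb hnb
  have h1 : x ∈ (R.snoc x b nb).new ⟨R.n, Nat.lt_succ_self _⟩ := by
    rw [new_snoc_of_not_lt (fun h' => hx (h.bag_subset _ h')) hxb hb
      (i := ⟨R.n, Nat.lt_succ_self _⟩) (lt_irrefl _)]
    rfl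
  have h2 := hn.lastVertex_upTo h1
  rwa [upTo_eq_self _ _ rfl] at h2

theorem exists_admissible (U : Type u) (t : ℕ) {k : ℕ} (hk : 0 < k) :
    ∃ P : PathPresentation U, P.Admissible t k := by
  refine ⟨⟨⊥, 0, fun _ => ∅⟩, ?_, ?_, ?_⟩
  · rw [isNice_iff]
    refine ⟨by simp, by simp, by simp, by simp, rfl, fun i => Fin.elim0 i⟩
  · rw [cliqueFree_iff _ hk]
    rintro ⟨f, h, -⟩
    exact h
  · rw [width_le_iff]
    simp

/-- The presentation `P₀`, continued by the vertices on the path from the root to `x` in a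
layout of `G`, under the names given by `ι`. -/
noncomputable def play {V : Type v} {G : SimpleGraph V} {s : ℕ} (P₀ : PathPresentation U)
    (L : Layout G s) (ι : V → U) (x : V) : PathPresentation U :=
  match _h : L.par x with
  | none => P₀.snoc (ι x) (ι '' L.bag x) (ι '' {y | y ∈ L.bag x ∧ G.Adj y x})
  | some p => (play P₀ L ι p).snoc (ι x) (ι '' L.bag x) (ι '' {y | y ∈ L.bag x ∧ G.Adj y x})
termination_by L.rank x
decreasing_by exact L.rank_par _h

/-- `R` is a nice path decomposition, with bags of size at most `s`, of a subgraph of the disjoint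
union of the graph of `P₀` and the copy of `G` under `ι`, and `R` starts as `P₀`. -/
structure Extends {V : Type v} (P₀ : PathPresentation U) (G : SimpleGraph V) (s : ℕ) (ι : V → U)
    (R : PathPresentation U) : Prop where
  isNice : R.IsNice
  verts : ∀ a ∈ R.graph.verts, a ∈ P₀.graph.verts ∨ ∃ y, a = ι y
  adj : ∀ a b, R.graph.Adj a b → P₀.graph.Adj a b ∨ ∃ y z, a = ι y ∧ b = ι z ∧ G.Adj y z
  ncard_bag : ∀ z, (R.bag z).ncard ≤ s
  isPrefix : ∀ i, (P₀.upTo i).IsPrefix R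

section

variable {V : Type v} {G : SimpleGraph V} {s : ℕ} {ι : V → U}

theorem Extends.snoc (h : P₀.Extends G s ι R) {x : V} {b : Set U} {nb : Set V}
    (hx : ι x ∉ R.graph.verts) (hxb : ι x ∈ b) (hb : b ⊆ insert (ι x) (R.bag (Fin.last _)))
    (hnb : ι '' nb ⊆ b) (hadj : ∀ y ∈ nb, G.Adj y x) (hs : b.ncard ≤ s) :
    P₀.Extends G s ι (R.snoc (ι x) b (ι '' nb)) where
  isNice := h.isNice.snoc hx hxb hb hnb
  verts := by
    rintro a (rfl | ha)
    · exact Or.inr ⟨x, rfl⟩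
    · exact h.verts a ha
  adj := by
    rintro a c (hac | ⟨rfl, -, ⟨y, hy, rfl⟩, -⟩ | ⟨rfl, -, ⟨y, hy, rfl⟩, -⟩)
    · exact h.adj a c hac
    · exact Or.inr ⟨x, y, rfl, rfl, (hadj y hy).symm⟩
    · exact Or.inr ⟨y, x, rfl, rfl, hadj y hy⟩
  ncard_bag := by
    intro z
    by_cases hz : z.val < R.n + 1
    · rw [bag_snoc_of_lt hz]
      exact h.ncard_bag _
    · rwa [bag_snoc_of_not_lt hz]
  isPrefix i := (h.isPrefix i).snoc h.isNice hx hxb hb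

/-- A clique of a disjoint union lies on one side. -/
theorem Extends.admissible (hP₀ : P₀.Admissible t k) (hk : 0 < k) (hG : G.CliqueFree k)
    (hι : ι.Injective) (hιP : ∀ x, ι x ∉ P₀.graph.verts) (h : P₀.Extends G (t + 1) ι R) :
    R.Admissible t k where
  isNice := h.isNice
  width_le := (width_le_iff _ t).2 h.ncard_bag
  cliqueFree := by
    rw [cliqueFree_iff _ hk]
    rintro ⟨f, h0, hf⟩
    by_cases hmem : f ⟨0, hk⟩ ∈ P₀.graph.verts
    · refine (cliqueFree_iff _ hk).1 hP₀.cliqueFree ⟨f, hmem, ?_⟩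
      have hall : ∀ i, f i ∈ P₀.graph.verts := by
        intro i
        by_cases hi : i = ⟨0, hk⟩
        · exact hi ▸ hmem
        · rcases h.adj _ _ (hf i _ hi) with h1 | ⟨y, z, -, hz, -⟩
          · exact P₀.graph.edge_vert h1
          · exact absurd (hz ▸ hmem) (hιP z)
      intro i j hij
      rcases h.adj _ _ (hf i j hij) with h1 | ⟨y, z, hy, -, -⟩
      · exact h1
      · exact absurd (hy ▸ hall i) (hιP y)
    · have hall : ∀ i, ∃ y, f i = ι y := by
        intro i
        by_cases hi : i = ⟨0, hk⟩
        · exact hi ▸ (h.verts _ h0).resolve_left hmem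
        · rcases h.adj _ _ (hf i _ hi) with h1 | ⟨y, z, hy, -, -⟩
          · exact absurd (P₀.graph.edge_vert h1.symm) hmem
          · exact ⟨y, hy⟩
      choose g hg using hall
      refine (cliqueFree_iff_forall_fin G k).1 hG ⟨g, fun i j hij => ?_⟩
      rcases h.adj _ _ (hf i j hij) with h1 | ⟨y, z, hy, hz, hyz⟩
      · exact absurd (hg i ▸ P₀.graph.edge_vert h1) (hιP _)
      · rw [hg] at hy hz
        rwa [hι hy, hι hz]

/-- What has been played before the vertex `x`: this is `P₀` if `x` is a child of the root of the
layout, and the presentation up to the parent of `x` otherwise. -/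
theorem exists_play_eq_snoc (L : Layout G s) (x : V) : ∃ R : PathPresentation U,
    P₀.play L ι x = R.snoc (ι x) (ι '' L.bag x) (ι '' {y | y ∈ L.bag x ∧ G.Adj y x}) ∧
    (L.par x = none ∧ R = P₀ ∨ ∃ p, L.par x = some p ∧ R = P₀.play L ι p) := by
  rw [play]
  split
  · next h => exact ⟨_, rfl, Or.inl ⟨h, rfl⟩⟩
  · next p h => exact ⟨_, rfl, Or.inr ⟨p, h, rfl⟩⟩

theorem play_spec [Nonempty U] (hP₀ : P₀.IsNice) (hs : ∀ z, (P₀.bag z).ncard ≤ s) (L : Layout G s)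
    (hι : ι.Injective) (hιP : ∀ x, ι x ∉ P₀.graph.verts) (x : V) :
    P₀.Extends G s ι (P₀.play L ι x) ∧
    (∀ y, ι y ∈ (P₀.play L ι x).graph.verts → L.rank y ≤ L.rank x) ∧
    (P₀.play L ι x).bag (Fin.last _) = ι '' L.bag x ∧
    (P₀.play L ι x).lastVertex = ι x ∧
    (∀ y ∈ L.bag x, (P₀.play L ι y).IsPrefix (P₀.play L ι x)) ∧
    ∀ y ∈ L.bag x, G.Adj y x → (P₀.play L ι x).graph.Adj (ι y) (ι x) := by
  induction hn : L.rank x using Nat.strong_induction_on generalizing x with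
  | _ n ih =>
    obtain ⟨R, hR, hcase⟩ := exists_play_eq_snoc (P₀ := P₀) (ι := ι) L x
    have key : P₀.Extends G s ι R ∧ (∀ y, ι y ∈ R.graph.verts → L.rank y < L.rank x) ∧
        (∀ y ∈ L.bag x, y ≠ x → ι y ∈ R.bag (Fin.last _)) ∧
        ∀ y ∈ L.bag x, y ≠ x → (P₀.play L ι y).IsPrefix R := by
      rcases hcase with ⟨hp, rfl⟩ | ⟨p, hp, rfl⟩
      · have hno : ∀ y ∈ L.bag x, y = x := by
          intro y hy
          by_contra hyx
          obtain ⟨p, hp', -⟩ := L.mem_bag_par hy hyx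
          rw [hp] at hp'
          cases hp'
        exact ⟨⟨hP₀, fun _ h => Or.inl h, fun _ _ h => Or.inl h, hs, fun i => ⟨i, rfl⟩⟩,
          fun y hy => absurd hy (hιP y), fun y hy hyx => absurd (hno y hy) hyx,
          fun y hy hyx => absurd (hno y hy) hyx⟩
      · have hlt := L.rank_par hp
        obtain ⟨h1, h2, h3, -, h5, -⟩ := ih _ (hn ▸ hlt) p rfl
        have hmem : ∀ y ∈ L.bag x, y ≠ x → y ∈ L.bag p := by
          intro y hy hyx
          obtain ⟨q, hq, hyq⟩ := L.mem_bag_par hy hyx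
          rw [hp] at hq
          cases hq
          exact hyq
        refine ⟨h1, fun y hy => (h2 y hy).trans_lt hlt, fun y hy hyx => ?_,
          fun y hy hyx => h5 y (hmem y hy hyx)⟩
        rw [h3]
        exact ⟨y, hmem y hy hyx, rfl⟩
    obtain ⟨hext, hrank, hbag, hpre⟩ := key
    have hx : ι x ∉ R.graph.verts := fun h => lt_irrefl _ (hrank x h)
    have hxb : ι x ∈ ι '' L.bag x := ⟨x, L.mem_bag x, rfl⟩
    have hb : ι '' L.bag x ⊆ insert (ι x) (R.bag (Fin.last _)) := by
      rintro _ ⟨y, hy, rfl⟩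
      by_cases hyx : y = x
      · exact Or.inl (by rw [hyx])
      · exact Or.inr (hbag y hy hyx)
    have hnb : ι '' {y | y ∈ L.bag x ∧ G.Adj y x} ⊆ ι '' L.bag x :=
      Set.image_mono fun y hy => hy.1
    rw [← hn]
    refine ⟨?_, ?_, ?_, ?_, ?_, ?_⟩
    · rw [hR]
      refine hext.snoc hx hxb hb hnb (fun y hy => hy.2) ?_
      rw [Set.ncard_image_of_injective _ hι]
      exact L.ncard_bag x
    · rw [hR]
      rintro y (hy | hy)
      · rw [hι hy]
      · exact (hrank y hy).le
    · rw [hR]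
      exact bag_snoc_of_not_lt (z := Fin.last (R.n + 1)) (by simp)
    · rw [hR]
      exact hext.isNice.lastVertex_snoc hx hxb hb hnb
    · intro y hy
      by_cases hyx : y = x
      · rw [hyx]
        exact isPrefix_self (by rw [hR]; exact Nat.succ_pos _)
      · rw [hR]
        exact (hpre y hy hyx).snoc hext.isNice hx hxb hb
    · intro y hy hyx
      rw [hR]
      exact Or.inr (Or.inr ⟨rfl, hι.ne hyx.ne, ⟨y, ⟨hy, hyx⟩, rfl⟩,
        hext.isNice.bag_subset _ (hbag y hy hyx.ne)⟩)

end

end PathPresentation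

open PathPresentation

theorem exists_injective_notMem {U : Type u} [Infinite U] (V : Type v) [Finite V] {F : Set U}
    (hF : F.Finite) : ∃ ι : V → U, ι.Injective ∧ ∀ x, ι x ∉ F := by
  have : Infinite (Fᶜ : Set U) := hF.infinite_compl.to_subtype
  obtain ⟨n, ⟨e⟩⟩ := Finite.exists_equiv_fin V
  let g : ℕ ↪ (Fᶜ : Set U) := Infinite.natEmbedding _
  refine ⟨fun x => g (e x), fun x y h => ?_, fun x => (g (e x)).2⟩
  exact e.injective (Fin.ext (g.injective (Subtype.ext h)))

/-- The adversary first presents an admissible `P₀` on which the algorithm uses as many colors as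
it ever does on admissible presentations. Whatever it presents afterwards receives the same colors,
so the colors given to the last vertices of `P₀.play L ι x` form a coloring of `G` with at most
`c` colors. -/
theorem colorable_of_algorithm {U : Type u} [Infinite U] {t k c : ℕ} (hk : 0 < k)
    (A : OnlineColoringAlgorithm U)
    (hA : ∀ P : PathPresentation U, P.Admissible t k → A.numColors P ≤ c)
    {V : Type v} [Finite V] {G : SimpleGraph V} (hG : G.CliqueFree k) (L : Layout G (t + 1)) :
    G.Colorable c := by
  classical
  have hex : ∃ P₀ : PathPresentation U, P₀.Admissible t k ∧
      ∀ P : PathPresentation U, P.Admissible t k → A.numColors P ≤ A.numColors P₀ := by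
    let S : Set ℕ := {m | ∃ P : PathPresentation U, P.Admissible t k ∧ A.numColors P = m}
    have hbdd : BddAbove S := ⟨c, by rintro _ ⟨P, hP, rfl⟩; exact hA P hP⟩
    obtain ⟨P₁, hP₁⟩ := exists_admissible U t hk
    obtain ⟨P₀, hP₀, h0⟩ := Nat.sSup_mem (s := S) ⟨_, P₁, hP₁, rfl⟩ hbdd
    exact ⟨P₀, hP₀, fun P hP => h0 ▸ le_csSup hbdd ⟨P, hP, rfl⟩⟩
  obtain ⟨P₀, hP₀, hmax⟩ := hex
  obtain ⟨ι, hι, hιP⟩ := exists_injective_notMem (U := U) V hP₀.isNice.finite_verts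
  have spec := play_spec hP₀.isNice ((width_le_iff _ t).1 hP₀.width_le) L hι hιP
  let C : Set ℤ := Set.range fun i : Fin P₀.n => A.color (P₀.upTo i)
  have hC : ∀ x, A.color (P₀.play L ι x) ∈ C := by
    intro x
    obtain ⟨hext, -, -, -, hpre, -⟩ := spec x
    have hadm := hext.admissible hP₀ hk hG hι hιP
    have hsub : C ⊆ Set.range fun i => A.color ((P₀.play L ι x).upTo i) := by
      rintro _ ⟨i, rfl⟩
      obtain ⟨j, hj⟩ := hext.isPrefix i
      exact ⟨j, congrArg A.color hj.symm⟩
    -- The colors on `P₀` occur again, and by maximality there is no room for another one.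
    have heq := Set.eq_of_subset_of_ncard_le hsub (hmax _ hadm) (Set.finite_range _)
    obtain ⟨j, hj⟩ := hpre x (L.mem_bag x)
    rw [heq]
    exact ⟨j, congrArg A.color hj.symm⟩
  have hproper : ∀ x y, x ∈ L.bag y → G.Adj x y →
      A.color (P₀.play L ι x) ≠ A.color (P₀.play L ι y) := by
    intro x y hx hxy
    obtain ⟨hext, -, -, hly, hpre, hadj⟩ := spec y
    obtain ⟨i, hi⟩ := hpre x hx
    obtain ⟨j, hj⟩ := hpre y (L.mem_bag y)
    have h1 := hext.isNice.lastVertex_upTo_mem i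
    have h2 := hext.isNice.lastVertex_upTo_mem j
    rw [← hi, (spec x).2.2.2.1] at h1
    rw [← hj, hly] at h2
    have h3 := A.proper _ hext.isNice i j _ h1 _ h2 (hadj x hx hxy)
    rwa [← hi, ← hj] at h3
  have hcol : G.Coloring C := Coloring.mk (fun x => ⟨A.color (P₀.play L ι x), hC x⟩) (by
    intro x y hxy h
    have h' := congrArg Subtype.val h
    rcases L.adj hxy with hx | hy
    · exact hproper x y hx hxy h'
    · exact hproper y x hy hxy.symm h'.symm)
  have hfin : Fintype C := Fintype.ofFinite C
  refine hcol.colorable.mono ?_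
  rw [← Nat.card_eq_fintype_card, Nat.card_coe_set_eq]
  exact hA P₀ hP₀

end OnlineColoring

theorem lemma3 (U : Type u) [Infinite U] (t k : ℕ) (ht : 0 < t) (hk : 0 < k) :
    (∃ c : ℕ,
      IsGreatest {m : ℕ | ∃ (V : Type v) (_ : Finite V) (G : SimpleGraph V),
        G.CliqueFree k ∧ OnlineColoring.treeWidth G ≤ t ∧ G.chromaticNumber = m} c ∧
      ∃ A : OnlineColoring.OnlineColoringAlgorithm U,
        ∀ P : OnlineColoring.PathPresentation U, P.IsNice → P.graph.coe.CliqueFree k →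
          OnlineColoring.width P.bag ≤ t → A.numColors P ≤ c) ∧
    (∀ (A' : OnlineColoring.OnlineColoringAlgorithm U) (c' : ℕ),
      (∀ P : OnlineColoring.PathPresentation U, P.IsNice → P.graph.coe.CliqueFree k →
          OnlineColoring.width P.bag ≤ t → A'.numColors P ≤ c') →
        ∀ (V : Type v) [Finite V] (G : SimpleGraph V), G.CliqueFree k →
          OnlineColoring.treeWidth G ≤ t → G.chromaticNumber ≤ c') := by
  constructor
  · let S : Set ℕ := {m : ℕ | ∃ (V : Type v) (_ : Finite V) (G : SimpleGraph V),
        G.CliqueFree k ∧ OnlineColoring.treeWidth G ≤ t ∧ G.chromaticNumber = m}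
    have hbdd : BddAbove S := by
      refine ⟨t + 1, ?_⟩
      rintro m ⟨V, _, G, -, htw, hm⟩
      obtain ⟨L⟩ := OnlineColoring.Layout.exists_of_treeWidth_le htw
      have h1 := L.colorable.chromaticNumber_le
      rw [hm] at h1
      exact_mod_cast h1
    have hmem : ∀ (V : Type v) [Finite V] (G : SimpleGraph V), G.CliqueFree k →
        OnlineColoring.treeWidth G ≤ t → G.chromaticNumber.toNat ∈ S := by
      intro V _ G hG htw
      obtain ⟨L⟩ := OnlineColoring.Layout.exists_of_treeWidth_le htw
      refine ⟨V, inferInstance, G, hG, htw, (ENat.natCast_toNat ?_).symm⟩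
      exact ne_top_of_le_ne_top (ENat.natCast_ne_top _) L.colorable.chromaticNumber_le
    have hne : S.Nonempty := by
      refine ⟨_, hmem PEmpty ⊥ ?_ ?_⟩
      · rw [OnlineColoring.cliqueFree_iff_forall_fin]
        rintro ⟨f, -⟩
        exact (f ⟨0, hk⟩).elim
      · rw [OnlineColoring.treeWidth_le_iff]
        exact ⟨Unit, inferInstance, ⊥, fun _ => ∅, ⟨SimpleGraph.IsTree.of_subsingleton,
          fun x => x.elim, fun x => x.elim⟩, by simp⟩
    refine ⟨sSup S, ⟨Nat.sSup_mem hne hbdd, fun m hm => le_csSup hbdd hm⟩, ?_⟩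
    obtain ⟨A, hA⟩ := OnlineColoring.exists_algorithm.{u, v} U (t := t) (c := sSup S) hk
      (fun V _ G hG htw => (G.colorable_chromaticNumber_of_fintype).mono
        (le_csSup hbdd (hmem V G hG htw)))
    exact ⟨A, fun P h1 h2 h3 => hA P ⟨h1, h2, h3⟩⟩
  · intro A' c' hA' V _ G hG htw
    obtain ⟨L⟩ := OnlineColoring.Layout.exists_of_treeWidth_le htw
    exact (OnlineColoring.colorable_of_algorithm hk A'
      (fun P hP => hA' P hP.isNice hP.cliqueFree hP.width_le) hG L).chromaticNumber_le
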